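/- Let $F=\mathbb F_q$ be a finite field with $q$ odd, and let $t$ be a positive integer. For a field $K$, let $\mathfrak{sl}_2(K)$ be the Lie algebra of trace-zero $2\times 2$ matrices over $K$, and write $\mathfrak{sl}_2(p)=\mathfrak{sl}_2(\mathbb F_p)$. A Lie polynomial over $K$ in two variables is an element $w$ of the free Lie algebra of rank $2$ over $K$; its image on a Lie algebra $L$ over $K$ is $w(L)=\{w(x,y)\mid x,y\in L\}$. Orbits in $\mathfrak{sl}_2(K)$ are taken under conjugation by $\mathrm{GL}_2(K)$. An element is split semisimple if it is $\mathrm{GL}_2(K)$-conjugate to $\begin{pmatrix}\lambda&0\\0&-\lambda\end{pmatrix}$ with $\lambda\in K$, $\lambda\neq 0$, and anisotropic semisimple if it is $\mathrm{GL}_2(K)$-conjugate to $\begin{pmatrix}0&a\\1&0\end{pmatrix}$ with $a\in K$ not a square in $K$; an orbit is called split (anisotropic) semisimple if its elements are. Then: 1. There is a Lie polynomial in two variables over $F$ whose image on $\mathfrak{sl}_2(F)$ is exactly the set of all nilpotent elements of $\mathfrak{sl}_2(F)$ (including $0$). 2. If $t$ is even, there are infinitely many odd primes $p$ such that, for each of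 them, there are infinitely many Lie polynomials in two variables over $\mathbb F_p$ whose image on $\mathfrak{sl}_2(p)$ contains no nonzero nilpotent element, exactly $\frac t2$ split semisimple orbits, and exactly $\frac t2$ anisotropic semisimple orbits. 3. There are infinitely many odd primes $p$ such that, for each of them, there are infinitely many Lie polynomials in two variables over $\mathbb F_p$ whose image on $\mathfrak{sl}_2(p)$ contains no nonzero nilpotent element, no anisotropic semisimple element, and exactly $t$ split semisimple orbits. 4. There are infinitely many odd primes $p$ such that, for each of them, there are infinitely many Lie polynomials in two variables over $\mathbb F_p$ whose image on $\mathfrak{sl}_2(p)$ contains no nonzero nilpotent element, no split semisimple element, and exactly $t$ anisotropic semisimple orbits. -/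

import Mathlib

/-- The Lie algebra of `2 × 2` matrices of trace zero. -/
abbrev SL2 (R : Type*) [CommRing R] : Type _ :=
  LieAlgebra.SpecialLinear.sl (Fin 2) R

/-- The image `w(L)` of the Lie polynomial map `L ^ k → L`, `(v₁, …, v_k) ↦ w(v₁, …, v_k)`,
defined by an element `w` of the free Lie algebra of rank `k`. -/
def lieImage {R : Type*} [CommRing R] {k : ℕ} (w : FreeLieAlgebra R (Fin k))
    (L : Type*) [LieRing L] [LieAlgebra R L] : Set L :=
  Set.range fun v : Fin k → L => FreeLieAlgebra.lift R v w

namespace SL2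

variable {R : Type*} [CommRing R]

/-- The orbit of `A` under the conjugation action of `GL₂`. -/
def orbit (A : SL2 R) : Set (SL2 R) :=
  {B | ∃ g : GL (Fin 2) R,
    (B : Matrix (Fin 2) (Fin 2) R) = g.val * (A : Matrix (Fin 2) (Fin 2) R) * (g⁻¹).val}

/-- Nilpotent elements (zero included). -/
def Nilpotent (A : SL2 R) : Prop :=
  IsNilpotent (A : Matrix (Fin 2) (Fin 2) R)

/-- Split semisimple elements: conjugate over the base field to `diag(l, -l)` with `l ≠ 0`. -/
def SplitSemisimple (A : SL2 R) : Prop :=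
  ∃ (D : SL2 R) (l : R), l ≠ 0 ∧ (D : Matrix (Fin 2) (Fin 2) R) = !![l, 0; 0, -l] ∧ A ∈ orbit D

/-- Anisotropic semisimple elements: conjugate over the base field to `!![0, a; 1, 0]`
with `a` not a square. -/
def AnisotropicSemisimple (A : SL2 R) : Prop :=
  ∃ (D : SL2 R) (a : R), ¬ IsSquare a ∧
    (D : Matrix (Fin 2) (Fin 2) R) = !![0, a; 1, 0] ∧ A ∈ orbit D

/-- The set of split semisimple orbits contained in `S`. -/
def splitOrbitsIn (S : Set (SL2 R)) : Set (Set (SL2 R)) :=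
  {O | (∃ A : SL2 R, SplitSemisimple A ∧ O = orbit A) ∧ O ⊆ S}

/-- The set of anisotropic semisimple orbits contained in `S`. -/
def anisotropicOrbitsIn (S : Set (SL2 R)) : Set (Set (SL2 R)) :=
  {O | (∃ A : SL2 R, AnisotropicSemisimple A ∧ O = orbit A) ∧ O ⊆ S}

/-- `S` contains no nonzero nilpotent element. -/
def NoNilpotents (S : Set (SL2 R)) : Prop :=
  ∀ A ∈ S, Nilpotent A → A = 0

end SL2

/-!
Write `δ(A) = -det A` for a traceless `2 × 2` matrix `A`, so that `A ^ 2 = δ(A)`.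

Every function on a finite field is a polynomial. Hence, if the values of a Lie polynomial `u` are
eigenvectors of an operator built from `ad x` and `ad y`, with an eigenvalue `c(x, y)`, then
`f(c(x, y)) • u(x, y)` is again given by a Lie polynomial, for an arbitrary function `f`
(`exists_lift_eq_smul`). Two cases of this carry the proof.

* `(ad x) ^ 2` multiplies `[x, [x, y]]` by `4 δ(x)`. With `f` the indicator function of `0` this
  gives a Lie polynomial which equals `[x, [x, y]] = -2 x y x` if `x` is nilpotent and vanishes
  otherwise. Its image is the nilpotent cone (`exists_lieImage_eq_nilpotent`).
* `((ad x ad y) ^ 2 - (ad x) ^ 2 (ad y) ^ 2) / 4` multiplies `z = [x, y]` by `δ(z)`. Since every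
  traceless matrix is a commutator, every set of the form `{0} ∪ {A | δ(A) ∈ S}` with `0 ∉ S` is
  the image of a Lie polynomial (`exists_lieImage_eq_levelSet`).

Such a set contains no nonzero nilpotent element, and a semisimple orbit is determined by the value
of `δ`, which is a nonzero square on split orbits and a nonsquare on anisotropic ones. So the split
(anisotropic) orbits in the set are counted by the squares (nonsquares) in `S`, and over `𝔽_p` with
`p > 2 t` there are enough of both. Finally, the free Lie algebra of rank two is infinite and there
are finitely many maps `L ^ 2 → L`, so every image on a finite `L` is attained infinitely often
(`infinite_setOf_lieImage_eq`).
-/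

/-! ### Lie polynomials as maps on a finite Lie algebra -/

/-- The iterated brackets `[x, [x, …, [x, y]]]` are pairwise distinct: evaluated at
`x = diag(X, 0)` and `y = E₁₂` over `R[X]`, they become `X ^ n • E₁₂`. -/
theorem FreeLieAlgebra.infinite_fin_two (R : Type*) [CommRing R] [Nontrivial R] :
    Infinite (FreeLieAlgebra R (Fin 2)) := by
  let : LieRing (Matrix (Fin 2) (Fin 2) (Polynomial R)) := LieRing.ofAssociativeRing
  let x := FreeLieAlgebra.of R (0 : Fin 2)
  let y := FreeLieAlgebra.of R (1 : Fin 2)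
  let v : Fin 2 → Matrix (Fin 2) (Fin 2) (Polynomial R) :=
    ![!![Polynomial.X, 0; 0, 0], !![0, 1; 0, 0]]
  have h (n : ℕ) : FreeLieAlgebra.lift R v ((fun a => ⁅x, a⁆)^[n] y) =
      !![0, Polynomial.X ^ n; 0, 0] := by
    induction n with
    | zero => simp [y, v]
    | succ n ih =>
      rw [Function.iterate_succ_apply', LieHom.map_lie, ih]
      ext i j
      fin_cases i <;> fin_cases j <;> simp [x, v, Ring.lie_def, pow_succ']
  refine Infinite.of_injective (fun n : ℕ => (fun a => ⁅x, a⁆)^[n] y) fun m n hmn => ?_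
  have := congrArg (FreeLieAlgebra.lift R v) hmn
  simp only [h] at this
  have h01 := congrFun (congrFun this 0) 1
  have := congrArg Polynomial.natDegree h01
  simpa using this

theorem infinite_setOf_lieImage_eq {R : Type*} [CommRing R] [Nontrivial R]
    (L : Type*) [LieRing L] [LieAlgebra R L] [Finite L] (w : FreeLieAlgebra R (Fin 2)) :
    {w' : FreeLieAlgebra R (Fin 2) | lieImage w' L = lieImage w L}.Infinite := by
  have := FreeLieAlgebra.infinite_fin_two R
  obtain ⟨y, hy⟩ := Finite.exists_infinite_fiber
    (fun (u : FreeLieAlgebra R (Fin 2)) (v : Fin 2 → L) => FreeLieAlgebra.lift R v u)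
  obtain ⟨w₁, hw₁⟩ := hy.nonempty
  refine (Set.infinite_coe_iff.mp hy |>.image (f := fun u => w + u - w₁)
    fun a _ b _ hab => by simpa using hab).mono ?_
  rintro _ ⟨u, hu, rfl⟩
  -- `u` and `w₁` lie in the same fibre, so `u - w₁` is an identity of `L`.
  have h (v : Fin 2 → L) : FreeLieAlgebra.lift R v u = FreeLieAlgebra.lift R v w₁ :=
    congrFun (hu.trans hw₁.symm) v
  simp [lieImage, h]

/-- If an operator `T` on Lie polynomials induces an operator `T'` at each evaluation point `v`,
and `u(v)` satisfies `T' u(v) = c(v) • u(v)`, then any function of `c` times `u` is a Lie polynomial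
map over a finite field: interpolate `f` by a polynomial `P` and take `P(T) u`. -/
theorem exists_lift_eq_smul {F L : Type*} [Field F] [Finite F] [LieRing L] [LieAlgebra F L]
    (T : Module.End F (FreeLieAlgebra F (Fin 2))) (T' : (Fin 2 → L) → Module.End F L)
    (hT : ∀ v a, FreeLieAlgebra.lift F v (T a) = T' v (FreeLieAlgebra.lift F v a))
    (u : FreeLieAlgebra F (Fin 2)) (c : (Fin 2 → L) → F)
    (hu : ∀ v, T' v (FreeLieAlgebra.lift F v u) = c v • FreeLieAlgebra.lift F v u) (f : F → F) :
    ∃ w, ∀ v : Fin 2 → L,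
      FreeLieAlgebra.lift F v w = f (c v) • FreeLieAlgebra.lift F v u := by
  classical
  have := Fintype.ofFinite F
  suffices h : ∀ P : Polynomial F, ∃ w, ∀ v : Fin 2 → L,
      FreeLieAlgebra.lift F v w = P.eval (c v) • FreeLieAlgebra.lift F v u by
    obtain ⟨w, hw⟩ := h (Lagrange.interpolate Finset.univ id f)
    refine ⟨w, fun v => ?_⟩
    rw [hw]
    have := Lagrange.eval_interpolate_at_node (v := id) f Function.injective_id.injOn
      (Finset.mem_univ (c v))
    simp only [id] at this
    exact congrArg (· • _) this
  intro P
  induction P using Polynomial.induction_on with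
  | C a => exact ⟨a • u, fun v => by simp⟩
  | add p q hp hq =>
    obtain ⟨w₁, h₁⟩ := hp
    obtain ⟨w₂, h₂⟩ := hq
    exact ⟨w₁ + w₂, fun v => by simp [h₁, h₂, add_smul]⟩
  | monomial n a h =>
    obtain ⟨w, hw⟩ := h
    refine ⟨T w, fun v => ?_⟩
    rw [hT, hw, map_smul, hu, smul_smul]
    simp [pow_succ, mul_assoc]

/-! ### Traceless matrices and their commutators -/

namespace SL2

section Ring

variable {R : Type*} [CommRing R]

/-- The traceless matrix with rows `(a, b)` and `(c, -a)`. -/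
def mk (a b c : R) : SL2 R :=
  ⟨!![a, b; c, -a], by
    change Matrix.trace !![a, b; c, -a] = 0
    simp [Matrix.trace]⟩

theorem exists_eq_mk (A : SL2 R) : ∃ a b c, A = mk a b c := by
  obtain ⟨M, hM⟩ := A
  have h : M 0 0 + M 1 1 = 0 := by
    simpa [Matrix.trace] using (show Matrix.trace M = 0 from hM)
  refine ⟨M 0 0, M 0 1, M 1 0, Subtype.ext ?_⟩
  ext i j
  fin_cases i <;> fin_cases j <;> simp [mk, eq_neg_of_add_eq_zero_right h]

theorem mk_inj {a b c a' b' c' : R} : mk a b c = mk a' b' c' ↔ a = a' ∧ b = b' ∧ c = c' := by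
  refine ⟨fun h => ?_, by rintro ⟨rfl, rfl, rfl⟩; rfl⟩
  have h := congrArg Subtype.val h
  exact ⟨congrFun (congrFun h 0) 0, congrFun (congrFun h 0) 1, congrFun (congrFun h 1) 0⟩

theorem zero_eq_mk : (0 : SL2 R) = mk 0 0 0 :=
  Subtype.ext <| by ext i j; fin_cases i <;> fin_cases j <;> simp [mk]

theorem smul_mk (r a b c : R) : r • mk a b c = mk (r * a) (r * b) (r * c) :=
  Subtype.ext <| by ext i j; fin_cases i <;> fin_cases j <;> simp [mk]

theorem mk_sub_mk (a b c a' b' c' : R) :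
    mk a b c - mk a' b' c' = mk (a - a') (b - b') (c - c') :=
  Subtype.ext <| by ext i j; fin_cases i <;> fin_cases j <;> simp [mk]; ring

theorem mk_lie_mk (a b c a' b' c' : R) :
    ⁅mk a b c, mk a' b' c'⁆ =
      mk (b * c' - c * b') (2 * (a * b' - b * a')) (2 * (c * a' - a * c')) :=
  Subtype.ext <| by
    rw [LieAlgebra.SpecialLinear.sl_bracket]
    ext i j
    fin_cases i <;> fin_cases j <;> simp [mk] <;> ring

/-- The invariant `δ(A) = -det A`, for which `A ^ 2 = δ(A)`. -/
def disc (A : SL2 R) : R :=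
  -(A : Matrix (Fin 2) (Fin 2) R).det

@[simp]
theorem disc_mk (a b c : R) : disc (mk a b c) = a ^ 2 + b * c := by
  simp [disc, mk, Matrix.det_fin_two]
  ring

@[simp]
theorem disc_zero : disc (0 : SL2 R) = 0 := by
  simp [zero_eq_mk]

theorem disc_eq_of_mem_orbit {A B : SL2 R} (h : B ∈ orbit A) : disc B = disc A := by
  obtain ⟨g, hg⟩ := h
  rw [disc, disc, hg, Matrix.det_units_conj]

theorem mem_orbit_self (A : SL2 R) : A ∈ orbit A :=
  ⟨1, by simp⟩

theorem orbit_eq_of_mem {A B : SL2 R} (h : B ∈ orbit A) : orbit B = orbit A := by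
  obtain ⟨g, hg⟩ := h
  ext C
  constructor
  · rintro ⟨k, hk⟩
    exact ⟨k * g, by rw [hk, hg]; simp [mul_assoc]⟩
  · rintro ⟨k, hk⟩
    refine ⟨k * g⁻¹, ?_⟩
    rw [hk, hg]
    simp [mul_assoc]

/-- The Weyl group swaps the two diagonal entries. -/
theorem mk_neg_mem_orbit (l : R) : mk (-l) 0 0 ∈ orbit (mk l 0 0) := by
  refine ⟨⟨!![0, 1; 1, 0], !![0, 1; 1, 0], ?_, ?_⟩, ?_⟩
  · simp [Matrix.one_fin_two]
  · simp [Matrix.one_fin_two]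
  · simp [mk]

theorem nilpotent_iff [IsDomain R] (A : SL2 R) : Nilpotent A ↔ disc A = 0 := by
  constructor
  · rintro ⟨n, hn⟩
    have h := congrArg Matrix.det hn
    rw [Matrix.det_pow, Matrix.det_zero] at h
    rw [disc, eq_zero_of_pow_eq_zero h, neg_zero]
  · obtain ⟨a, b, c, rfl⟩ := exists_eq_mk A
    intro h
    rw [disc_mk] at h
    refine ⟨2, ?_⟩
    ext i j
    fin_cases i <;> fin_cases j <;> simp [mk, pow_two]
    · linear_combination h
    · ring
    · ring
    · linear_combination h

theorem splitSemisimple_iff {A : SL2 R} :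
    SplitSemisimple A ↔ ∃ l : R, l ≠ 0 ∧ A ∈ orbit (mk l 0 0) := by
  constructor
  · rintro ⟨D, l, hl, hD, hA⟩
    exact ⟨l, hl, by rwa [show mk l 0 0 = D from Subtype.ext hD.symm]⟩
  · rintro ⟨l, hl, hA⟩
    exact ⟨_, l, hl, rfl, hA⟩

theorem anisotropicSemisimple_iff {A : SL2 R} :
    AnisotropicSemisimple A ↔ ∃ a : R, ¬ IsSquare a ∧ A ∈ orbit (mk 0 a 1) := by
  constructor
  · rintro ⟨D, a, ha, hD, hA⟩
    exact ⟨a, ha, by rwa [show mk 0 a 1 = D from Subtype.ext (by simp [hD, mk])]⟩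
  · rintro ⟨a, ha, hA⟩
    exact ⟨_, a, ha, by simp [mk], hA⟩

theorem SplitSemisimple.isSquare_disc {A : SL2 R} (h : SplitSemisimple A) :
    IsSquare (disc A) := by
  obtain ⟨l, -, hA⟩ := splitSemisimple_iff.mp h
  exact ⟨l, by rw [disc_eq_of_mem_orbit hA]; simp [pow_two]⟩

theorem SplitSemisimple.disc_ne_zero [IsDomain R] {A : SL2 R} (h : SplitSemisimple A) :
    disc A ≠ 0 := by
  obtain ⟨l, hl, hA⟩ := splitSemisimple_iff.mp h
  simpa [disc_eq_of_mem_orbit hA] using hl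

theorem AnisotropicSemisimple.not_isSquare_disc {A : SL2 R} (h : AnisotropicSemisimple A) :
    ¬ IsSquare (disc A) := by
  obtain ⟨a, ha, hA⟩ := anisotropicSemisimple_iff.mp h
  simpa [disc_eq_of_mem_orbit hA] using ha

theorem SplitSemisimple.orbit_eq [IsDomain R] {A B : SL2 R} (hA : SplitSemisimple A)
    (hB : SplitSemisimple B) (h : disc A = disc B) : orbit A = orbit B := by
  obtain ⟨l, -, hA⟩ := splitSemisimple_iff.mp hA
  obtain ⟨m, -, hB⟩ := splitSemisimple_iff.mp hB
  rw [disc_eq_of_mem_orbit hA, disc_eq_of_mem_orbit hB] at h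
  rw [orbit_eq_of_mem hA, orbit_eq_of_mem hB]
  simp only [disc_mk, mul_zero, add_zero] at h
  obtain rfl | rfl := sq_eq_sq_iff_eq_or_eq_neg.mp h
  · rfl
  · exact orbit_eq_of_mem (mk_neg_mem_orbit m)

theorem AnisotropicSemisimple.orbit_eq {A B : SL2 R} (hA : AnisotropicSemisimple A)
    (hB : AnisotropicSemisimple B) (h : disc A = disc B) : orbit A = orbit B := by
  obtain ⟨a, -, hA⟩ := anisotropicSemisimple_iff.mp hA
  obtain ⟨b, -, hB⟩ := anisotropicSemisimple_iff.mp hB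
  rw [disc_eq_of_mem_orbit hA, disc_eq_of_mem_orbit hB] at h
  rw [orbit_eq_of_mem hA, orbit_eq_of_mem hB]
  have h : a = b := by simpa using h
  rw [h]

end Ring

section Field

variable {F : Type*} [Field F]

/-! ### Lie polynomials with prescribed image -/

theorem lie_lie_lie_lie (x y : SL2 F) :
    ⁅x, ⁅x, ⁅x, ⁅x, y⁆⁆⁆⁆ = (4 * disc x) • ⁅x, ⁅x, y⁆⁆ := by
  obtain ⟨a, b, c, rfl⟩ := exists_eq_mk x
  obtain ⟨a', b', c', rfl⟩ := exists_eq_mk y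
  simp only [mk_lie_mk, smul_mk, disc_mk, mk_inj]
  refine ⟨?_, ?_, ?_⟩ <;> ring

/-- Let `B` be the symmetric bilinear form with `B(x, x) = δ(x)`. The operators `(ad x) ^ 2`,
`(ad y) ^ 2` and `ad x ad y` multiply `[x, y]` by `4 δ(x)`, `4 δ(y)` and `4 B(x, y)`, and
`δ([x, y]) = 4 (B(x, y) ^ 2 - δ(x) δ(y))`. -/
theorem lie_lie_sub_lie_lie (x y : SL2 F) :
    ⁅x, ⁅y, ⁅x, ⁅y, ⁅x, y⁆⁆⁆⁆⁆ - ⁅x, ⁅x, ⁅y, ⁅y, ⁅x, y⁆⁆⁆⁆⁆ = (4 * disc ⁅x, y⁆) • ⁅x, y⁆ := by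
  obtain ⟨a, b, c, rfl⟩ := exists_eq_mk x
  obtain ⟨a', b', c', rfl⟩ := exists_eq_mk y
  simp only [mk_lie_mk, smul_mk, disc_mk, mk_sub_mk, mk_inj]
  refine ⟨?_, ?_, ?_⟩ <;> ring

/-- Every `z` has some `x` with `tr(x z) = 0` and `δ(x) ≠ 0`. For such an `x`,
`[x, [x, z]] = 4 δ(x) • z`, so that `z` is a commutator. -/
theorem exists_lie_eq (h2 : (2 : F) ≠ 0) (z : SL2 F) : ∃ x y : SL2 F, ⁅x, y⁆ = z := by
  obtain ⟨a, b, c, rfl⟩ := exists_eq_mk z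
  have key (x : SL2 F) (hx : disc x ≠ 0)
      (h : ⁅x, ⁅x, mk a b c⁆⁆ = (4 * disc x) • mk a b c) : ∃ x y : SL2 F, ⁅x, y⁆ = mk a b c := by
    refine ⟨x, (4 * disc x)⁻¹ • ⁅x, mk a b c⁆, ?_⟩
    have h4 : (4 * disc x) ≠ 0 := by
      rw [show (4 : F) = 2 * 2 by norm_num]
      exact mul_ne_zero (mul_ne_zero h2 h2) hx
    rw [lie_smul, h, smul_smul, inv_mul_cancel₀ h4, one_smul]
  by_cases hc : c = 0
  · by_cases hb : b = 0
    · subst hb hc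
      refine key (mk 0 1 1) (by simp) ?_
      simp only [mk_lie_mk, smul_mk, disc_mk, mk_inj]
      refine ⟨?_, ?_, ?_⟩ <;> ring
    · refine key (mk b 0 (-2 * a)) (by simpa using hb) ?_
      simp only [mk_lie_mk, smul_mk, disc_mk, mk_inj]
      refine ⟨?_, ?_, ?_⟩ <;> ring
  · refine key (mk c (-2 * a) 0) (by simpa using hc) ?_
    simp only [mk_lie_mk, smul_mk, disc_mk, mk_inj]
    refine ⟨?_, ?_, ?_⟩ <;> ring

theorem exists_lieImage_eq_nilpotent [Finite F] (h2 : (2 : F) ≠ 0) :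
    ∃ w : FreeLieAlgebra F (Fin 2), lieImage w (SL2 F) = {A | Nilpotent A} := by
  classical
  let X := FreeLieAlgebra.of F (0 : Fin 2)
  let Y := FreeLieAlgebra.of F (1 : Fin 2)
  have h4 : (4 : F) ≠ 0 := by
    rw [show (4 : F) = 2 * 2 by norm_num]
    exact mul_ne_zero h2 h2
  obtain ⟨w, hw⟩ := exists_lift_eq_smul (L := SL2 F)
    (LieAlgebra.ad F _ X * LieAlgebra.ad F _ X)
    (fun v => LieAlgebra.ad F _ (v 0) * LieAlgebra.ad F _ (v 0)) (by simp [X]) ⁅X, ⁅X, Y⁆⁆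
    (fun v => 4 * disc (v 0)) (by simp [X, Y, lie_lie_lie_lie]) (fun d => if d = 0 then 1 else 0)
  refine ⟨w, Set.ext fun N => ?_⟩
  simp only [lieImage, hw, Set.mem_range, Set.mem_ofPred_eq, nilpotent_iff]
  constructor
  · rintro ⟨v, rfl⟩
    split_ifs with hv
    · simp only [mul_eq_zero, h4, false_or] at hv
      simp only [LieHom.map_lie, FreeLieAlgebra.lift_of_apply, X, Y, one_smul]
      generalize v 0 = x at hv ⊢
      generalize v 1 = y
      obtain ⟨a, b, c, rfl⟩ := exists_eq_mk x
      obtain ⟨a', b', c', rfl⟩ := exists_eq_mk y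
      simp only [mk_lie_mk, disc_mk] at hv ⊢
      -- `δ([x, z]) = -4 δ(x) δ(z)` for `z = [x, y]`, as `x` and `z` are orthogonal.
      linear_combination
        (-4 * ((b * c' - c * b') ^ 2 + 2 * (a * b' - b * a') * (2 * (c * a' - a * c')))) * hv
    · simp
  · obtain ⟨a, b, c, rfl⟩ := exists_eq_mk N
    intro hN
    -- If `s` is a multiple of `E₂₁` or `E₁₂`, then `-2 N s N` is a multiple of `N`.
    suffices ∃ y, ⁅mk a b c, ⁅mk a b c, y⁆⁆ = mk a b c by
      obtain ⟨y, hy⟩ := this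
      exact ⟨![mk a b c, y], by simp [X, Y, hN, hy]⟩
    rw [disc_mk] at hN
    by_cases hb : b = 0
    · by_cases hc : c = 0
      · subst hb hc
        have ha : a = 0 := by simpa using hN
        subst ha
        exact ⟨0, by simp [← zero_eq_mk]⟩
      · have ha : a = 0 := by simpa [hb] using hN
        subst ha hb
        refine ⟨mk 0 (-1 / (2 * c)) 0, ?_⟩
        simp only [mk_lie_mk, mk_inj]
        refine ⟨?_, ?_, ?_⟩ <;> field_simp <;> ring
    · obtain rfl : c = -a ^ 2 / b := by
        field_simp
        linear_combination hN
      refine ⟨mk 0 0 (-1 / (2 * b)), ?_⟩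
      simp only [mk_lie_mk, mk_inj]
      refine ⟨?_, ?_, ?_⟩ <;> field_simp <;> ring

theorem exists_lieImage_eq_levelSet [Finite F] (h2 : (2 : F) ≠ 0) {S : Set F} (hS : 0 ∉ S) :
    ∃ w : FreeLieAlgebra F (Fin 2), lieImage w (SL2 F) = {A | A = 0 ∨ disc A ∈ S} := by
  classical
  let X := FreeLieAlgebra.of F (0 : Fin 2)
  let Y := FreeLieAlgebra.of F (1 : Fin 2)
  have h4 : (4 : F) ≠ 0 := by
    rw [show (4 : F) = 2 * 2 by norm_num]
    exact mul_ne_zero h2 h2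
  let T {L : Type _} [LieRing L] [LieAlgebra F L] (x y : L) : Module.End F L :=
    LieAlgebra.ad F L x * LieAlgebra.ad F L y * LieAlgebra.ad F L x * LieAlgebra.ad F L y -
      LieAlgebra.ad F L x * LieAlgebra.ad F L x * LieAlgebra.ad F L y * LieAlgebra.ad F L y
  obtain ⟨w, hw⟩ := exists_lift_eq_smul (L := SL2 F) (T X Y) (fun v => T (v 0) (v 1))
    (by simp [T, X, Y]) ⁅X, Y⁆ (fun v => 4 * disc ⁅v 0, v 1⁆)
    (by simp [T, X, Y, lie_lie_sub_lie_lie]) (fun d => if d / 4 ∈ S then 1 else 0)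
  simp only [mul_div_cancel_left₀ _ h4] at hw
  refine ⟨w, Set.ext fun A => ?_⟩
  simp only [lieImage, hw, Set.mem_range, Set.mem_ofPred_eq]
  constructor
  · rintro ⟨v, rfl⟩
    split_ifs with hv
    · right
      simpa [X, Y] using hv
    · simp
  · rintro (rfl | hA)
    · exact ⟨0, by simp [hS]⟩
    · obtain ⟨x, y, rfl⟩ := exists_lie_eq h2 A
      exact ⟨![x, y], by simp [X, Y, hA]⟩

/-! ### Counting orbits -/

variable {S : Set F}

theorem noNilpotents_levelSet (hS : 0 ∉ S) : NoNilpotents {A : SL2 F | A = 0 ∨ disc A ∈ S} := by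
  rintro A (hA | hA) hN
  · exact hA
  · rw [nilpotent_iff] at hN
    exact absurd (hN ▸ hA) hS

theorem ncard_splitOrbitsIn (hS : 0 ∉ S) :
    (splitOrbitsIn {A : SL2 F | A = 0 ∨ disc A ∈ S}).ncard = {d ∈ S | IsSquare d}.ncard := by
  have hm {l : F} (hl : l * l ∈ S) : SplitSemisimple (mk l 0 0) :=
    splitSemisimple_iff.mpr ⟨l, by rintro rfl; simp_all, mem_orbit_self _⟩
  symm
  refine Set.ncard_congr (fun d hd => orbit (mk hd.2.choose 0 0)) ?_ ?_ ?_
  · intro d hd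
    have h := hd.2.choose_spec
    refine ⟨⟨_, hm (h ▸ hd.1), rfl⟩, fun B hB => Or.inr ?_⟩
    rw [disc_eq_of_mem_orbit hB]
    simpa [pow_two, ← h] using hd.1
  · intro d e hd he hde
    have h := disc_eq_of_mem_orbit (hde ▸ mem_orbit_self (mk hd.2.choose 0 0))
    simpa [pow_two, ← hd.2.choose_spec, ← he.2.choose_spec] using h
  · rintro O ⟨⟨A, hA, rfl⟩, hO⟩
    have hd : disc A ∈ S :=
      (hO (mem_orbit_self A)).resolve_left fun h => hA.disc_ne_zero (by simp [h])
    have h := hA.isSquare_disc.choose_spec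
    refine ⟨disc A, ⟨hd, hA.isSquare_disc⟩, SplitSemisimple.orbit_eq (hm (h ▸ hd)) hA ?_⟩
    simpa [pow_two] using h.symm

theorem ncard_anisotropicOrbitsIn (S : Set F) :
    (anisotropicOrbitsIn {A : SL2 F | A = 0 ∨ disc A ∈ S}).ncard =
      {d ∈ S | ¬ IsSquare d}.ncard := by
  have hm {a : F} (ha : ¬ IsSquare a) : AnisotropicSemisimple (mk 0 a 1) :=
    anisotropicSemisimple_iff.mpr ⟨a, ha, mem_orbit_self _⟩
  symm
  refine Set.ncard_congr (fun d _ => orbit (mk 0 d 1)) ?_ ?_ ?_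
  · intro d hd
    refine ⟨⟨_, hm hd.2, rfl⟩, fun B hB => Or.inr ?_⟩
    rw [disc_eq_of_mem_orbit hB]
    simpa using hd.1
  · intro d e _ _ hde
    have hmem : mk 0 d 1 ∈ orbit (mk 0 e 1) := hde ▸ mem_orbit_self (mk 0 d 1)
    simpa using disc_eq_of_mem_orbit hmem
  · rintro O ⟨⟨A, hA, rfl⟩, hO⟩
    have hs := hA.not_isSquare_disc
    have hd : disc A ∈ S := (hO (mem_orbit_self A)).resolve_left fun h => hs (by simp [h])
    exact ⟨disc A, ⟨hd, hs⟩, AnisotropicSemisimple.orbit_eq (hm hs) hA (by simp)⟩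

theorem not_splitSemisimple_of_mem_levelSet (h : ∀ d ∈ S, ¬ IsSquare d) {A : SL2 F}
    (hA : A = 0 ∨ disc A ∈ S) : ¬ SplitSemisimple A := by
  intro hs
  obtain rfl | hA := hA
  · exact hs.disc_ne_zero disc_zero
  · exact h _ hA hs.isSquare_disc

theorem not_anisotropicSemisimple_of_mem_levelSet (h : ∀ d ∈ S, IsSquare d) {A : SL2 F}
    (hA : A = 0 ∨ disc A ∈ S) : ¬ AnisotropicSemisimple A := by
  intro hs
  obtain rfl | hA := hA
  · exact hs.not_isSquare_disc (by simp)
  · exact hs.not_isSquare_disc (h _ hA)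

/-- Any property of images which holds for `{0} ∪ {A | δ(A) ∈ S}` holds for the images of infinitely
many Lie polynomials. -/
theorem infinite_setOf_lieImage_of_levelSet [Finite F] (h2 : (2 : F) ≠ 0) (hS : 0 ∉ S)
    {P : Set (SL2 F) → Prop} (hP : P {A : SL2 F | A = 0 ∨ disc A ∈ S}) :
    {w : FreeLieAlgebra F (Fin 2) | P (lieImage w (SL2 F))}.Infinite := by
  obtain ⟨w, hw⟩ := exists_lieImage_eq_levelSet h2 hS
  refine (infinite_setOf_lieImage_eq (SL2 F) w).mono fun w' hw' => ?_
  rw [Set.mem_ofPred_eq] at hw' ⊢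
  rwa [hw', hw]

end Field

end SL2

/-! ### Squares and nonsquares modulo a prime -/

theorem infinite_setOf_prime_of_forall_lt (n : ℕ) {P : ℕ → Prop}
    (h : ∀ p, p.Prime → n < p → P p) : {p : ℕ | p.Prime ∧ p ≠ 2 ∧ P p}.Infinite := by
  refine Set.infinite_of_forall_exists_gt fun m => ?_
  obtain ⟨p, hp, hpp⟩ := Nat.exists_infinite_primes (m + n + 3)
  exact ⟨p, ⟨hpp, by omega, h p hpp (by omega)⟩, by omega⟩

theorem ZMod.exists_squares_nonsquares {p : ℕ} [Fact p.Prime] {t : ℕ} (ht : 2 * t < p)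
    (hp : 2 < p) :
    ∃ Q N : Set (ZMod p), (∀ d ∈ Q, IsSquare d) ∧ (∀ d ∈ N, ¬ IsSquare d) ∧
      0 ∉ Q ∧ 0 ∉ N ∧ Q.ncard = t ∧ N.ncard = t := by
  have hpow (i : ℕ) (hi : i ∈ Set.Icc 1 t) : (i : ZMod p) ≠ 0 := by
    rw [Ne, ZMod.natCast_eq_zero_iff]
    exact Nat.not_dvd_of_pos_of_lt hi.1 (by have := hi.2; omega)
  have hinj : Set.InjOn (fun i : ℕ => (i : ZMod p) ^ 2) (Set.Icc 1 t) := by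
    intro i hi j hj hij
    simp only [Set.mem_Icc] at hi hj
    obtain h | h := sq_eq_sq_iff_eq_or_eq_neg.mp hij
    · rw [ZMod.natCast_eq_natCast_iff'] at h
      rwa [Nat.mod_eq_of_lt (by omega), Nat.mod_eq_of_lt (by omega)] at h
    · -- `0 < i + j ≤ 2 t < p`
      have h : ((i + j : ℕ) : ZMod p) = 0 := by push_cast; rw [h]; ring
      rw [ZMod.natCast_eq_zero_iff] at h
      exact absurd h (Nat.not_dvd_of_pos_of_lt (by omega) (by omega))
  obtain ⟨n, hn⟩ := FiniteField.exists_nonsquare (F := ZMod p) (by rw [ZMod.ringChar_zmod_n]; omega)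
  have hn0 : n ≠ 0 := by rintro rfl; simp at hn
  refine ⟨(fun i : ℕ => (i : ZMod p) ^ 2) '' Set.Icc 1 t,
    (fun i : ℕ => n * (i : ZMod p) ^ 2) '' Set.Icc 1 t, ?_, ?_, ?_, ?_, ?_, ?_⟩
  · rintro _ ⟨i, -, rfl⟩
    exact IsSquare.sq _
  · rintro _ ⟨i, hi, rfl⟩ h
    refine hn ?_
    have := h.div (IsSquare.sq (i : ZMod p))
    rwa [mul_div_cancel_right₀ _ (pow_ne_zero 2 (hpow i hi))] at this
  · rintro ⟨i, hi, h⟩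
    exact pow_ne_zero 2 (hpow i hi) h
  · rintro ⟨i, hi, h⟩
    exact mul_ne_zero hn0 (pow_ne_zero 2 (hpow i hi)) h
  · rw [hinj.ncard_image, ← Nat.card_coe_set_eq]
    simp
  · rw [Set.InjOn.ncard_image fun i hi j hj h => hinj hi hj (mul_left_cancel₀ hn0 h),
      ← Nat.card_coe_set_eq]
    simp

theorem mainTheorem2 {F : Type*} [Field F] [Finite F] (hF : Odd (Nat.card F))
    (t : ℕ) (ht : 0 < t) :
    (∃ w : FreeLieAlgebra F (Fin 2), lieImage w (SL2 F) = {A | SL2.Nilpotent A}) ∧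
    (Even t →
      {p : ℕ | p.Prime ∧ p ≠ 2 ∧
        {w : FreeLieAlgebra (ZMod p) (Fin 2) |
          SL2.NoNilpotents (lieImage w (SL2 (ZMod p))) ∧
          (SL2.splitOrbitsIn (lieImage w (SL2 (ZMod p)))).ncard = t / 2 ∧
          (SL2.anisotropicOrbitsIn (lieImage w (SL2 (ZMod p)))).ncard = t / 2}.Infinite}.Infinite) ∧
    {p : ℕ | p.Prime ∧ p ≠ 2 ∧
      {w : FreeLieAlgebra (ZMod p) (Fin 2) |
        SL2.NoNilpotents (lieImage w (SL2 (ZMod p))) ∧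
        (∀ A ∈ lieImage w (SL2 (ZMod p)), ¬ SL2.AnisotropicSemisimple A) ∧
        (SL2.splitOrbitsIn (lieImage w (SL2 (ZMod p)))).ncard = t}.Infinite}.Infinite ∧
    {p : ℕ | p.Prime ∧ p ≠ 2 ∧
      {w : FreeLieAlgebra (ZMod p) (Fin 2) |
        SL2.NoNilpotents (lieImage w (SL2 (ZMod p))) ∧
        (∀ A ∈ lieImage w (SL2 (ZMod p)), ¬ SL2.SplitSemisimple A) ∧
        (SL2.anisotropicOrbitsIn (lieImage w (SL2 (ZMod p)))).ncard = t}.Infinite}.Infinite := by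
  have two_ne (p : ℕ) (hp : 2 < p) : (2 : ZMod p) ≠ 0 := by
    have h : ((2 : ℕ) : ZMod p) ≠ 0 := by
      rw [Ne, ZMod.natCast_eq_zero_iff]
      exact Nat.not_dvd_of_pos_of_lt two_pos hp
    exact_mod_cast h
  refine ⟨?_, fun _ => ?_, ?_, ?_⟩
  · refine SL2.exists_lieImage_eq_nilpotent (Ring.two_ne_zero fun h => ?_)
    have := Fintype.ofFinite F
    rw [Nat.card_eq_fintype_card, ← Nat.not_even_iff_odd, Nat.even_iff] at hF
    exact hF (FiniteField.even_card_of_char_two h)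
  · refine infinite_setOf_prime_of_forall_lt (2 * t + 2) fun p hp htp => ?_
    have := Fact.mk hp
    obtain ⟨Q, N, hQ, hN, hQ0, hN0, hQt, hNt⟩ :=
      ZMod.exists_squares_nonsquares (p := p) (t := t / 2) (by omega) (by omega)
    have h0 : 0 ∉ Q ∪ N := by simp [hQ0, hN0]
    refine SL2.infinite_setOf_lieImage_of_levelSet (two_ne p (by omega)) h0
      (P := fun I => SL2.NoNilpotents I ∧ (SL2.splitOrbitsIn I).ncard = t / 2 ∧
        (SL2.anisotropicOrbitsIn I).ncard = t / 2)
      ⟨SL2.noNilpotents_levelSet h0, ?_, ?_⟩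
    · rw [SL2.ncard_splitOrbitsIn h0, ← hQt]
      congr 1
      ext d
      have := hQ d
      have := hN d
      simp only [Set.mem_ofPred_eq, Set.mem_union]
      tauto
    · rw [SL2.ncard_anisotropicOrbitsIn, ← hNt]
      congr 1
      ext d
      have := hQ d
      have := hN d
      simp only [Set.mem_ofPred_eq, Set.mem_union]
      tauto
  · refine infinite_setOf_prime_of_forall_lt (2 * t + 2) fun p hp htp => ?_
    have := Fact.mk hp
    obtain ⟨Q, -, hQ, -, hQ0, -, hQt, -⟩ :=
      ZMod.exists_squares_nonsquares (p := p) (t := t) (by omega) (by omega)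
    refine SL2.infinite_setOf_lieImage_of_levelSet (two_ne p (by omega)) hQ0
      (P := fun I => SL2.NoNilpotents I ∧ (∀ A ∈ I, ¬ SL2.AnisotropicSemisimple A) ∧
        (SL2.splitOrbitsIn I).ncard = t)
      ⟨SL2.noNilpotents_levelSet hQ0,
        fun A hA => SL2.not_anisotropicSemisimple_of_mem_levelSet hQ hA, ?_⟩
    rw [SL2.ncard_splitOrbitsIn hQ0, Set.sep_eq_self_iff_mem_true.mpr hQ, hQt]
  · refine infinite_setOf_prime_of_forall_lt (2 * t + 2) fun p hp htp => ?_
    have := Fact.mk hp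
    obtain ⟨-, N, -, hN, -, hN0, -, hNt⟩ :=
      ZMod.exists_squares_nonsquares (p := p) (t := t) (by omega) (by omega)
    refine SL2.infinite_setOf_lieImage_of_levelSet (two_ne p (by omega)) hN0
      (P := fun I => SL2.NoNilpotents I ∧ (∀ A ∈ I, ¬ SL2.SplitSemisimple A) ∧
        (SL2.anisotropicOrbitsIn I).ncard = t)
      ⟨SL2.noNilpotents_levelSet hN0,
        fun A hA => SL2.not_splitSemisimple_of_mem_levelSet hN hA, ?_⟩
    rw [SL2.ncard_anisotropicOrbitsIn, Set.sep_eq_self_iff_mem_true.mpr hN, hNt]
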